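/- Let $n\in\mathbb{N}$ and let $A,B$ be $n\times n$ complex matrices with $A$ positive semidefinite and $B$ positive definite. Powers and logarithms of positive semidefinite matrices are taken in the sense of functional calculus, with $\log 0:=0$ on the kernel of a singular matrix (which amounts to the usual convention $0\log 0=0$). Then all the traces below are real, and \begin{align*} \mathrm{Tr}\, AB^{-1}A(\log A-\log B) &\le\mathrm{Tr}\, A^{1/2}B^{-1}A^{3/2}\log(A^{1/2}B^{-1}A^{1/2})\\ &=\mathrm{Tr}\, B^{-1/2}A^2B^{-1/2}\log(B^{-1/2}AB^{-1/2})\\ &=\mathrm{Tr}\, A^{3/2}B^{-1}A^{1/2}\log(A^{1/2}B^{-1}A^{1/2})\\ &\le\mathrm{Tr}\, A^2B^{-1}(\log A-\log B). \end{align*} -/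

import Mathlib

open scoped MatrixOrder ComplexOrder

/-!
Writing `C = B⁻¹`, `S = A ^ (1 / 2)` and `M = S * C * S`, each trace is a sum of integrals against
joint spectral measures of a left and a right multiplication: the middle ones are integrals of
`x y log x` for `(L_M, R_A)`. After a common term is removed, each inequality
compares two integrals of the form `∫ φ log τ` with the same `∫ φ`. Since the derivative in `s` of
`∫ φ log (τ + s)` is the resolvent integral `∫ φ / (τ + s)` and the differences vanish as
`s → ∞`, it suffices to compare resolvent integrals for every `s > 0`.

A resolvent integral is a trace in the solution `Y` of a linear matrix equation,
`A Y C + s Y = A` for the upper bound and `M Y + s Y A = A` for the lower bound. The trace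
on the other side of the comparison involves `W = S (M + s)⁻¹ S`, which solves `A C W + s W = A`,
respectively `Q = (C + s)⁻¹`, for which `S Q` solves the equation of `Y S` up to a commutator.
The difference of the two traces is a positive combination of energies of residuals: `Y C - C W`
and `W - Y` in the first case, `Y S - S Q` and `Q A - A Q` in the second.
-/

section LogarithmicSums

open Filter Topology

variable {ι : Type*} [Fintype ι] {α t : ι → ℝ}

theorem tendsto_sum_mul_log_add_atTop (hα : ∑ i, α i = 0) :
    Tendsto (fun s => ∑ i, α i * Real.log (t i + s)) atTop (𝓝 0) := by
  have h : Tendsto (fun s => ∑ i, α i * (Real.log (s + t i) - Real.log s)) atTop (𝓝 0) := by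
    simpa only [mul_zero, Finset.sum_const_zero] using tendsto_finsetSum Finset.univ fun i _ =>
      (Real.tendsto_log_comp_add_sub_log (t i)).const_mul (α i)
  refine h.congr fun s => ?_
  simp only [mul_sub, Finset.sum_sub_distrib, ← Finset.sum_mul, hα, zero_mul, sub_zero,
    add_comm s]

theorem tendsto_sum_mul_log_add_nhds_zero (hαt : ∀ i, t i = 0 → α i = 0) :
    Tendsto (fun s => ∑ i, α i * Real.log (t i + s)) (𝓝 0)
      (𝓝 (∑ i, α i * Real.log (t i))) := by
  refine tendsto_finsetSum _ fun i _ => ?_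
  by_cases hi : t i = 0
  · simp [hαt i hi]
  · have h : Tendsto (fun s => t i + s) (𝓝 0) (𝓝 (t i)) := by
      simpa using (continuous_const_add (t i)).tendsto 0
    exact (h.log hi).const_mul _

theorem antitoneOn_sum_mul_log_add (ht : ∀ i, 0 ≤ t i)
    (hres : ∀ s : ℝ, 0 < s → ∑ i, α i / (t i + s) ≤ 0) :
    AntitoneOn (fun s => ∑ i, α i * Real.log (t i + s)) (Set.Ioi 0) := by
  have hderiv (s : ℝ) (hs : 0 < s) : HasDerivAt (fun s => ∑ i, α i * Real.log (t i + s))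
      (∑ i, α i / (t i + s)) s := by
    refine HasDerivAt.fun_sum fun i _ => ?_
    have := (((hasDerivAt_id s).const_add (t i)).log
      (add_pos_of_nonneg_of_pos (ht i) hs).ne').const_mul (α i)
    rwa [mul_one_div] at this
  refine antitoneOn_of_deriv_nonpos (convex_Ioi 0)
    (fun s hs => (hderiv s hs).continuousAt.continuousWithinAt) ?_ ?_ <;>
    rw [interior_Ioi]
  · exact fun s hs => (hderiv s hs).differentiableAt.differentiableWithinAt
  · exact fun s hs => (hderiv s hs).deriv.trans_le (hres s hs)

theorem sum_mul_log_nonneg_of_sum_div_add_nonpos (ht : ∀ i, 0 ≤ t i)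
    (hαt : ∀ i, t i = 0 → α i = 0) (hα : ∑ i, α i = 0)
    (hres : ∀ s : ℝ, 0 < s → ∑ i, α i / (t i + s) ≤ 0) :
    0 ≤ ∑ i, α i * Real.log (t i) := by
  refine ge_of_tendsto
    ((tendsto_sum_mul_log_add_nhds_zero hαt).mono_left (nhdsWithin_le_nhds (s := Set.Ioi 0))) ?_
  filter_upwards [self_mem_nhdsWithin] with s hs
  refine le_of_tendsto (tendsto_sum_mul_log_add_atTop (t := t) hα) ?_
  filter_upwards [eventually_ge_atTop s] with u hu
  exact antitoneOn_sum_mul_log_add ht hres hs (lt_of_lt_of_le hs hu) hu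

end LogarithmicSums

section SpectralForm

open Matrix

variable {n 𝕜 : Type*} [Fintype n] [DecidableEq n] [RCLike 𝕜] {H K : Matrix n n 𝕜}

/-- The matrix of `X` between the eigenbases of two Hermitian matrices `H` and `K`. -/
noncomputable def eigenCoord (hH : H.IsHermitian) (hK : K.IsHermitian) (X : Matrix n n 𝕜) :
    Matrix n n 𝕜 :=
  (hH.eigenvectorUnitary : Matrix n n 𝕜)ᴴ * X * hK.eigenvectorUnitary

/-- The double operator integral `φ(L_H, R_K) X`, where `L_H` is left multiplication by `H` and
`R_K` right multiplication by `K`: a Schur multiplier in the eigenbases of `H` and `K`. -/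
noncomputable def doubleOperatorIntegral (hH : H.IsHermitian) (hK : K.IsHermitian)
    (φ : ℝ → ℝ → ℝ) (X : Matrix n n 𝕜) : Matrix n n 𝕜 :=
  hH.eigenvectorUnitary *
    of (fun i j => (φ (hH.eigenvalues i) (hK.eigenvalues j) : 𝕜) * eigenCoord hH hK X i j) *
    (hK.eigenvectorUnitary : Matrix n n 𝕜)ᴴ

/-- The quadratic form `⟨X, φ(L_H, R_K) X⟩` in the Hilbert–Schmidt inner product, that is, the
integral of `φ` against the joint spectral measure of `L_H` and `R_K` at `X`. -/
noncomputable def spectralForm (hH : H.IsHermitian) (hK : K.IsHermitian) (X : Matrix n n 𝕜)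
    (φ : ℝ → ℝ → ℝ) : ℝ :=
  ∑ p : n × n, φ (hH.eigenvalues p.1) (hK.eigenvalues p.2) * ‖eigenCoord hH hK X p.1 p.2‖ ^ 2

theorem cfc_self_mul (hH : H.IsHermitian) (f : ℝ → ℝ) :
    cfc (fun x => x * f x) H = H * cfc f H := by
  have hcont (g : ℝ → ℝ) : ContinuousOn g (spectrum ℝ H) := finite_real_spectrum.continuousOn g
  rw [cfc_mul _ _ _ (hcont _) (hcont _), cfc_id' ℝ H hH.isSelfAdjoint]

variable (hH : H.IsHermitian) (hK : K.IsHermitian) (X : Matrix n n 𝕜) (f g : ℝ → ℝ)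
  (φ ψ : ℝ → ℝ → ℝ)

theorem eigenCoord_doubleOperatorIntegral (i j : n) :
    eigenCoord hH hK (doubleOperatorIntegral hH hK φ X) i j =
      (φ (hH.eigenvalues i) (hK.eigenvalues j) : 𝕜) * eigenCoord hH hK X i j := by
  have hU : (hH.eigenvectorUnitary : Matrix n n 𝕜)ᴴ * hH.eigenvectorUnitary = 1 :=
    Unitary.coe_star_mul_self _
  have hV : (hK.eigenvectorUnitary : Matrix n n 𝕜)ᴴ * hK.eigenvectorUnitary = 1 :=
    Unitary.coe_star_mul_self _
  rw [eigenCoord, doubleOperatorIntegral, ← Matrix.mul_assoc, ← Matrix.mul_assoc, hU,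
    Matrix.one_mul, Matrix.mul_assoc, hV, Matrix.mul_one, of_apply]

theorem cfc_mul_mul_cfc :
    cfc f H * X * cfc g K = doubleOperatorIntegral hH hK (fun x y => f x * g y) X := by
  have hdiag : of (fun i j => ((f (hH.eigenvalues i) * g (hK.eigenvalues j) : ℝ) : 𝕜) *
      eigenCoord hH hK X i j) =
      diagonal (fun i => (f (hH.eigenvalues i) : 𝕜)) * eigenCoord hH hK X *
        diagonal (fun j => (g (hK.eigenvalues j) : 𝕜)) := by
    ext i j
    rw [mul_diagonal, diagonal_mul, of_apply, RCLike.ofReal_mul]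
    ring
  rw [doubleOperatorIntegral, hdiag, hH.cfc_eq, hK.cfc_eq, IsHermitian.cfc, IsHermitian.cfc,
    Unitary.conjStarAlgAut_apply, Unitary.conjStarAlgAut_apply, eigenCoord]
  simp only [Matrix.mul_assoc, star_eq_conjTranspose, Function.comp_def]

theorem cfc_mul_eq_doubleOperatorIntegral :
    cfc f H * X = doubleOperatorIntegral hH hK (fun x _ => f x) X := by
  simpa only [cfc_const_one ℝ K hK.isSelfAdjoint, Matrix.mul_one, mul_one] using
    cfc_mul_mul_cfc hH hK X f fun _ => 1

theorem mul_cfc_eq_doubleOperatorIntegral :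
    X * cfc f K = doubleOperatorIntegral hH hK (fun _ y => f y) X := by
  simpa only [cfc_const_one ℝ H hH.isSelfAdjoint, Matrix.one_mul, one_mul] using
    cfc_mul_mul_cfc hH hK X (fun _ => 1) f

theorem mul_doubleOperatorIntegral :
    H * doubleOperatorIntegral hH hK φ X =
      doubleOperatorIntegral hH hK (fun x y => x * φ x y) X := by
  conv_lhs => enter [1]; rw [← cfc_id' ℝ H hH.isSelfAdjoint]
  rw [cfc_mul_eq_doubleOperatorIntegral hH hK, doubleOperatorIntegral]
  simp only [eigenCoord_doubleOperatorIntegral, ← mul_assoc, ← RCLike.ofReal_mul]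
  rfl

theorem doubleOperatorIntegral_mul :
    doubleOperatorIntegral hH hK φ X * K =
      doubleOperatorIntegral hH hK (fun x y => φ x y * y) X := by
  conv_lhs => enter [2]; rw [← cfc_id' ℝ K hK.isSelfAdjoint]
  rw [mul_cfc_eq_doubleOperatorIntegral hH hK, doubleOperatorIntegral]
  simp only [eigenCoord_doubleOperatorIntegral, ← mul_assoc, ← RCLike.ofReal_mul,
    mul_comm (φ _ _)]
  rfl

variable {φ ψ} in
theorem doubleOperatorIntegral_congr
    (h : ∀ i j, φ (hH.eigenvalues i) (hK.eigenvalues j) =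
      ψ (hH.eigenvalues i) (hK.eigenvalues j)) :
    doubleOperatorIntegral hH hK φ X = doubleOperatorIntegral hH hK ψ X := by
  simp only [doubleOperatorIntegral, h]

theorem doubleOperatorIntegral_add_smul (s : ℝ) :
    doubleOperatorIntegral hH hK φ X + s • doubleOperatorIntegral hH hK ψ X =
      doubleOperatorIntegral hH hK (fun x y => φ x y + s * ψ x y) X := by
  rw [doubleOperatorIntegral, doubleOperatorIntegral, doubleOperatorIntegral, ← Matrix.smul_mul,
    ← Matrix.mul_smul, ← Matrix.add_mul, ← Matrix.mul_add]
  congr 2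
  ext i j
  simp only [Matrix.add_apply, Matrix.smul_apply, of_apply, RCLike.real_smul_eq_coe_mul,
    RCLike.ofReal_add, RCLike.ofReal_mul, add_mul, mul_assoc]

theorem trace_conjTranspose_mul_doubleOperatorIntegral :
    (Xᴴ * doubleOperatorIntegral hH hK φ X).trace = (spectralForm hH hK X φ : 𝕜) := by
  have h (Z : Matrix n n 𝕜) : (Xᴴ * (hH.eigenvectorUnitary * Z *
      (hK.eigenvectorUnitary : Matrix n n 𝕜)ᴴ)).trace = (Z * (eigenCoord hH hK X)ᴴ).trace := by
    rw [eigenCoord, ← Matrix.mul_assoc, trace_mul_comm, trace_mul_comm Z]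
    simp only [conjTranspose_mul, conjTranspose_conjTranspose, Matrix.mul_assoc]
  rw [doubleOperatorIntegral, h, spectralForm, Fintype.sum_prod_type, RCLike.ofReal_sum]
  refine Finset.sum_congr rfl fun i _ => ?_
  rw [RCLike.ofReal_sum, diag_apply, mul_apply]
  refine Finset.sum_congr rfl fun j _ => ?_
  rw [of_apply, conjTranspose_apply, mul_assoc, RCLike.star_def, RCLike.mul_conj]
  push_cast
  rfl

theorem trace_conjTranspose_mul_cfc_mul_mul_cfc :
    (Xᴴ * (cfc f H * X * cfc g K)).trace =
      (spectralForm hH hK X (fun x y => f x * g y) : 𝕜) := by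
  rw [cfc_mul_mul_cfc hH hK, trace_conjTranspose_mul_doubleOperatorIntegral]

variable {X} in
include hH hK in
theorem cfc_mul_eq_mul_cfc (h : H * X = X * K) : cfc f H * X = X * cfc f K := by
  have hcoord (i j : n) : hH.eigenvalues i = hK.eigenvalues j ∨ eigenCoord hH hK X i j = 0 := by
    have hij : eigenCoord hH hK (cfc (fun x : ℝ => x) H * X) i j =
        eigenCoord hH hK (X * cfc (fun x : ℝ => x) K) i j := by
      rw [cfc_id' ℝ H hH.isSelfAdjoint, cfc_id' ℝ K hK.isSelfAdjoint, h]
    rw [cfc_mul_eq_doubleOperatorIntegral hH hK, mul_cfc_eq_doubleOperatorIntegral hH hK,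
      eigenCoord_doubleOperatorIntegral,
      eigenCoord_doubleOperatorIntegral] at hij
    simpa only [RCLike.ofReal_inj] using mul_eq_mul_right_iff.mp hij
  rw [cfc_mul_eq_doubleOperatorIntegral hH hK, mul_cfc_eq_doubleOperatorIntegral hH hK,
    doubleOperatorIntegral, doubleOperatorIntegral]
  congr 3
  ext i j
  rcases hcoord i j with hij | hij <;> simp [hij]

theorem spectralForm_add : spectralForm hH hK X (fun x y => φ x y + ψ x y) =
    spectralForm hH hK X φ + spectralForm hH hK X ψ := by
  simp only [spectralForm, add_mul, Finset.sum_add_distrib]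

variable {φ ψ} in
theorem spectralForm_congr
    (h : ∀ i j, φ (hH.eigenvalues i) (hK.eigenvalues j) =
      ψ (hH.eigenvalues i) (hK.eigenvalues j)) :
    spectralForm hH hK X φ = spectralForm hH hK X ψ := by
  simp only [spectralForm, h]

theorem trace_cfc_mul_cfc :
    (cfc f H * cfc g K).trace = (spectralForm hH hK 1 (fun x y => f x * g y) : 𝕜) := by
  simpa only [conjTranspose_one, Matrix.one_mul, Matrix.mul_one] using
    trace_conjTranspose_mul_cfc_mul_mul_cfc hH hK 1 f g

theorem spectralForm_mul_log_le_of_spectralForm_div_add_le {H' K' : Matrix n n 𝕜}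
    (hH' : H'.IsHermitian) (hK' : K'.IsHermitian) (X' : Matrix n n 𝕜) {φ τ φ' τ' : ℝ → ℝ → ℝ}
    (hτ : ∀ i j, 0 ≤ τ (hH.eigenvalues i) (hK.eigenvalues j))
    (hτ' : ∀ i j, 0 ≤ τ' (hH'.eigenvalues i) (hK'.eigenvalues j))
    (hφ : ∀ i j, τ (hH.eigenvalues i) (hK.eigenvalues j) = 0 →
      φ (hH.eigenvalues i) (hK.eigenvalues j) = 0)
    (hφ' : ∀ i j, τ' (hH'.eigenvalues i) (hK'.eigenvalues j) = 0 →
      φ' (hH'.eigenvalues i) (hK'.eigenvalues j) = 0)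
    (hmass : spectralForm hH hK X φ = spectralForm hH' hK' X' φ')
    (hres : ∀ s : ℝ, 0 < s → spectralForm hH hK X (fun x y => φ x y / (τ x y + s)) ≤
      spectralForm hH' hK' X' fun x y => φ' x y / (τ' x y + s)) :
    spectralForm hH' hK' X' (fun x y => φ' x y * Real.log (τ' x y)) ≤
      spectralForm hH hK X fun x y => φ x y * Real.log (τ x y) := by
  have h := sum_mul_log_nonneg_of_sum_div_add_nonpos
    (α := Sum.elim
      (fun p : n × n => φ (hH.eigenvalues p.1) (hK.eigenvalues p.2) *
        ‖eigenCoord hH hK X p.1 p.2‖ ^ 2)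
      (fun p : n × n => -(φ' (hH'.eigenvalues p.1) (hK'.eigenvalues p.2) *
        ‖eigenCoord hH' hK' X' p.1 p.2‖ ^ 2)))
    (t := Sum.elim (fun p => τ (hH.eigenvalues p.1) (hK.eigenvalues p.2))
      (fun p => τ' (hH'.eigenvalues p.1) (hK'.eigenvalues p.2)))
    (by rintro (p | p); exacts [hτ _ _, hτ' _ _])
    (by
      rintro (p | p) hp
      · exact mul_eq_zero_of_left (hφ _ _ hp) _
      · exact neg_eq_zero.mpr (mul_eq_zero_of_left (hφ' _ _ hp) _))
  simp only [spectralForm] at hmass hres ⊢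
  simp only [Fintype.sum_sum_type, Sum.elim_inl, Sum.elim_inr, neg_div, neg_mul,
    Finset.sum_neg_distrib, ← sub_eq_add_neg, sub_nonneg, sub_nonpos, sub_eq_zero,
    mul_div_right_comm, mul_right_comm _ _ (Real.log _)] at h
  exact h hmass hres

end SpectralForm

section ResolventInequalities

open Matrix

variable {n 𝕜 : Type*} [Fintype n] [RCLike 𝕜] {A C M Q S W Y : Matrix n n 𝕜} {s : ℝ}

theorem re_trace_conjTranspose (X : Matrix n n 𝕜) :
    RCLike.re Xᴴ.trace = RCLike.re X.trace := by
  rw [trace_conjTranspose, RCLike.star_def, RCLike.conj_re]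

theorem re_trace_conjTranspose_mul_mul_nonneg (hA : A.PosSemidef) (X : Matrix n n 𝕜) :
    0 ≤ RCLike.re (Xᴴ * A * X).trace :=
  (RCLike.nonneg_iff.mp (hA.conjTranspose_mul_mul_same X).trace_nonneg).1

theorem re_trace_conjTranspose_mul_mul_mul_nonneg (hA : A.PosSemidef) (hC : C.PosSemidef)
    (X : Matrix n n 𝕜) : 0 ≤ RCLike.re (Xᴴ * A * X * C).trace := by
  classical
  obtain ⟨D, rfl⟩ := CStarAlgebra.nonneg_iff_eq_star_mul_self.mp hC.nonneg
  have h := re_trace_conjTranspose_mul_mul_nonneg hA (X * Dᴴ)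
  rwa [conjTranspose_mul, conjTranspose_conjTranspose, Matrix.mul_assoc, Matrix.mul_assoc,
    trace_mul_comm, ← Matrix.mul_assoc, ← Matrix.mul_assoc, Matrix.mul_assoc _ Dᴴ] at h

theorem re_trace_mul_mul_le_of_stein (hA : A.PosSemidef) (hC : C.PosSemidef) (hs : 0 < s)
    (hW : Wᴴ = W) (hAW : A * C * W + s • W = A) (hY : A * Y * C + s • Y = A) :
    RCLike.re (A * Y * C).trace ≤ RCLike.re (A * C * W).trace := by
  have hWA : W * C * A + s • W = A := by
    have h := congrArg conjTranspose hAW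
    rwa [conjTranspose_add, conjTranspose_smul, conjTranspose_mul, conjTranspose_mul, hW,
      hA.isHermitian.eq, hC.isHermitian.eq, star_trivial, ← Matrix.mul_assoc] at h
  have hresidual : A * (Y * C - C * W) = s • (W - Y) := by
    rw [Matrix.mul_sub, ← Matrix.mul_assoc, ← Matrix.mul_assoc, eq_sub_of_add_eq hY,
      eq_sub_of_add_eq hAW, smul_sub]
    abel
  have hcomm : 0 ≤ RCLike.re (W * C * Y).trace - RCLike.re (Y * C * W).trace := by
    have hU := re_trace_conjTranspose_mul_mul_nonneg hA (Y * C - C * W)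
    have hV := re_trace_conjTranspose_mul_mul_nonneg hC (W - Y)ᴴ
    rw [Matrix.mul_assoc, hresidual, Matrix.mul_smul, trace_smul, RCLike.smul_re] at hU
    have hU' := nonneg_of_mul_nonneg_right hU hs
    refine (add_nonneg hU' hV).trans_eq ?_
    simp only [conjTranspose_sub, conjTranspose_mul, conjTranspose_conjTranspose, hW,
      hC.isHermitian.eq, Matrix.mul_sub, Matrix.sub_mul, trace_sub, map_sub]
    rw [trace_mul_comm (C * Yᴴ) W, trace_mul_comm (C * Yᴴ) Y, ← Matrix.mul_assoc,
      ← Matrix.mul_assoc]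
    ring
  have hdiff : RCLike.re (W * C * A).trace - RCLike.re (A * Y * C).trace =
      s * (RCLike.re (W * C * Y).trace - RCLike.re (Y * C * W).trace) := by
    have h1 : W * C * A = W * C * (A * Y * C) + s • (W * C * Y) := by
      rw [← Matrix.mul_smul, ← Matrix.mul_add, hY]
    have h2 : A * Y * C = W * C * (A * Y * C) + s • (W * Y * C) := by
      nth_rw 1 [← hWA]
      simp only [Matrix.add_mul, Matrix.smul_mul, Matrix.mul_assoc]
    have h := (congrArg₂ (· - ·) h1 h2).trans (add_sub_add_left_eq_sub _ _ _)
    rw [← trace_mul_comm W, ← Matrix.mul_assoc, ← map_sub, ← map_sub, ← trace_sub, ← trace_sub, h,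
      ← smul_sub, trace_smul, RCLike.smul_re]
  have hconj : RCLike.re (W * C * A).trace = RCLike.re (A * C * W).trace := by
    rw [← re_trace_conjTranspose, conjTranspose_mul, conjTranspose_mul, hW, hA.isHermitian.eq,
      hC.isHermitian.eq, Matrix.mul_assoc]
  linarith [mul_nonneg hs.le hcomm]

theorem re_trace_mul_commutator_nonpos (hA : Aᴴ = A) (hC : C.PosSemidef) (hQ : Qᴴ = Q) :
    RCLike.re (Q * A * C * (Q * A - A * Q) * C).trace ≤ 0 := by
  set K := Q * A - A * Q with hK
  have hK' : Kᴴ = -K := by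
    rw [hK, conjTranspose_sub, conjTranspose_mul, conjTranspose_mul, hA, hQ, neg_sub]
  have hpos : RCLike.re (Q * A * C * K * C).trace - RCLike.re (A * Q * C * K * C).trace ≤ 0 := by
    have h := re_trace_conjTranspose_mul_mul_mul_nonneg hC hC K
    rw [hK', Matrix.neg_mul, Matrix.neg_mul, Matrix.neg_mul, trace_neg, map_neg] at h
    rw [← map_sub, ← trace_sub, ← Matrix.sub_mul, ← Matrix.sub_mul, ← Matrix.sub_mul, ← hK]
    exact neg_nonneg.mp h
  have hconj : RCLike.re (A * Q * C * K * C).trace = -RCLike.re (Q * A * C * K * C).trace := by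
    rw [← re_trace_conjTranspose]
    simp only [conjTranspose_mul, hA, hQ, hK', hC.isHermitian.eq, Matrix.mul_neg, Matrix.neg_mul,
      trace_neg, map_neg]
    rw [← Matrix.mul_assoc, ← Matrix.mul_assoc, trace_mul_comm, ← Matrix.mul_assoc,
      ← Matrix.mul_assoc]
  linarith

theorem re_trace_conjTranspose_mul_sylvester_comm (hM : Mᴴ = M) (hA : Aᴴ = A)
    (X Z : Matrix n n 𝕜) : RCLike.re (Xᴴ * (M * Z + s • (Z * A))).trace =
      RCLike.re (Zᴴ * (M * X + s • (X * A))).trace := by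
  rw [← re_trace_conjTranspose]
  simp only [conjTranspose_mul, conjTranspose_add, conjTranspose_smul, conjTranspose_conjTranspose,
    hM, hA, star_trivial, Matrix.mul_add, Matrix.mul_smul, trace_add, trace_smul,
    Matrix.mul_assoc]
  rw [trace_mul_comm A, Matrix.mul_assoc]

theorem sylvester_residual [DecidableEq n] (hSA : S * S = A) (hSCS : S * C * S = M)
    (hCQ : C * Q + s • Q = 1) (hY : M * Y + s • (Y * A) = A) :
    M * (Y * S - S * Q) + s • ((Y * S - S * Q) * A) = S * C * (Q * A - A * Q) := by
  have hYS : M * (Y * S) + s • (Y * S * A) = S * A := by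
    have hSAS : S * A = A * S := by rw [← hSA, Matrix.mul_assoc]
    rw [Matrix.mul_assoc Y, hSAS, ← Matrix.mul_assoc, ← Matrix.mul_assoc, ← Matrix.smul_mul,
      ← Matrix.add_mul, hY]
  have hSQA : S * A = S * ((C * Q + s • Q) * A) := by rw [hCQ, Matrix.one_mul]
  rw [Matrix.mul_sub, Matrix.sub_mul, smul_sub, sub_add_sub_comm, hYS, hSQA, ← hSCS, ← hSA]
  simp only [Matrix.mul_add, Matrix.add_mul, Matrix.mul_sub, Matrix.smul_mul, Matrix.mul_smul,
    Matrix.mul_assoc]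
  abel

theorem re_trace_mul_commutator_le_of_sylvester [DecidableEq n] (hS : Sᴴ = S) (hSA : S * S = A)
    (hC : C.PosSemidef) (hSCS : S * C * S = M) (hs : 0 ≤ s) (hQ : Qᴴ = Q)
    (hCQ : C * Q + s • Q = 1) (hY : M * Y + s • (Y * A) = A) :
    RCLike.re (Q * A * C * (Q * A - A * Q)).trace ≤
      RCLike.re (A * A * Y).trace - RCLike.re (A * A * Q).trace := by
  set K := Q * A - A * Q
  set Z := Y * S - S * Q with hZ
  have hA : A.PosSemidef := by
    simpa only [hS, hSA] using posSemidef_self_mul_conjTranspose S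
  have hMpos : M.PosSemidef := by
    simpa only [hS, hSCS] using hC.mul_mul_conjTranspose_same S
  have hSAS : S * A = A * S := by rw [← hSA, Matrix.mul_assoc]
  have hYS : M * (Y * S) + s • (Y * S * A) = A * S := by
    rw [Matrix.mul_assoc Y, hSAS, ← Matrix.mul_assoc, ← Matrix.mul_assoc, ← Matrix.smul_mul,
      ← Matrix.add_mul, hY]
  have hLZ : M * Z + s • (Z * A) = S * C * K := sylvester_residual hSA hSCS hCQ hY
  have henergy : 0 ≤ RCLike.re (Zᴴ * (S * C * K)).trace := by
    have h1 := re_trace_conjTranspose_mul_mul_nonneg hMpos Z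
    have h2 := re_trace_conjTranspose_mul_mul_nonneg hA Zᴴ
    rw [← hLZ, Matrix.mul_add, Matrix.mul_smul, trace_add, trace_smul, map_add, RCLike.smul_re,
      trace_mul_comm _ (Z * A), ← Matrix.mul_assoc]
    rw [conjTranspose_conjTranspose] at h2
    positivity
  have hAAY : (S * A * (Y * S)).trace = (A * A * Y).trace := by
    rw [trace_mul_comm, Matrix.mul_assoc Y, ← Matrix.mul_assoc S, hSA, trace_mul_comm]
  have hAAQ : S * A * (S * Q) = A * A * Q := by
    rw [hSAS, ← hSA]
    simp only [Matrix.mul_assoc]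
  have hsymm : RCLike.re ((Y * S)ᴴ * (S * C * K)).trace =
      RCLike.re (A * A * Y).trace - RCLike.re (A * A * Q).trace := by
    rw [← hLZ, re_trace_conjTranspose_mul_sylvester_comm hMpos.isHermitian.eq hA.isHermitian.eq,
      hYS, ← re_trace_conjTranspose, conjTranspose_mul, conjTranspose_conjTranspose,
      conjTranspose_mul, hS, hA.isHermitian.eq, hZ, Matrix.mul_sub, trace_sub, map_sub,
      hAAY, hAAQ]
  have hsub : Zᴴ * (S * C * K) = (Y * S)ᴴ * (S * C * K) - Q * A * C * K := by
    rw [hZ, conjTranspose_sub, conjTranspose_mul S, hS, hQ, Matrix.sub_mul, ← hSA]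
    simp only [Matrix.mul_assoc]
  rw [hsub, trace_sub, map_sub, hsymm] at henergy
  linarith

theorem re_trace_mul_mul_le_of_sylvester [DecidableEq n] (hS : Sᴴ = S)
    (hSA : S * S = A) (hC : C.PosSemidef) (hSCS : S * C * S = M) (hs : 0 < s) (hQ : Qᴴ = Q)
    (hCQ : C * Q + s • Q = 1) (hY : M * Y + s • (Y * A) = A) :
    RCLike.re (M * Y * A).trace ≤ RCLike.re (A * C * A * Q).trace := by
  set K := Q * A - A * Q with hK
  have hA : Aᴴ = A := by rw [← hSA, conjTranspose_mul, hS]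
  have hres := re_trace_mul_commutator_le_of_sylvester hS hSA hC hSCS hs.le hQ hCQ hY
  have hcomm := re_trace_mul_commutator_nonpos hA hC hQ
  rw [← hK] at hres hcomm
  have hMYA : RCLike.re (M * Y * A).trace =
      RCLike.re (A * A).trace - s * RCLike.re (A * A * Y).trace := by
    rw [eq_sub_of_add_eq hY, Matrix.sub_mul, Matrix.smul_mul, trace_sub, trace_smul, map_sub,
      RCLike.smul_re, Matrix.mul_assoc Y, trace_mul_comm Y]
  have hAA : RCLike.re (A * A).trace - s * RCLike.re (A * A * Q).trace =
      RCLike.re (A * C * Q * A).trace := by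
    have h : A * (C * Q + s • Q) * A = A * A := by rw [hCQ, Matrix.mul_one]
    nth_rw 1 [← h]
    rw [Matrix.mul_add, Matrix.add_mul, trace_add, map_add, Matrix.mul_smul, Matrix.smul_mul,
      trace_smul, RCLike.smul_re, trace_mul_comm (A * Q), ← Matrix.mul_assoc A A,
      ← Matrix.mul_assoc, add_sub_cancel_right]
  have hACK : RCLike.re (A * C * K).trace =
      RCLike.re (Q * A * C * K * C).trace + s * RCLike.re (Q * A * C * K).trace := by
    have h : A * C * K * (C * Q + s • Q) = A * C * K := by rw [hCQ, Matrix.mul_one]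
    rw [← h, Matrix.mul_add, trace_add, map_add, Matrix.mul_smul, trace_smul, RCLike.smul_re,
      ← Matrix.mul_assoc, trace_mul_comm _ Q, trace_mul_comm _ Q]
    simp only [Matrix.mul_assoc]
  have hsplit : RCLike.re (A * C * K).trace =
      RCLike.re (A * C * Q * A).trace - RCLike.re (A * C * A * Q).trace := by
    rw [hK, Matrix.mul_sub, trace_sub, map_sub, ← Matrix.mul_assoc, ← Matrix.mul_assoc]
  linarith [mul_le_mul_of_nonneg_left hres hs.le]

end ResolventInequalities

section LogInequalities

open Matrix

variable {n 𝕜 : Type*} [Fintype n] [DecidableEq n] [RCLike 𝕜] {A C H M S : Matrix n n 𝕜} {s : ℝ}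

theorem mul_cfc_inv_add (hH : H.PosSemidef) (hs : 0 < s) :
    H * cfc (fun x : ℝ => (x + s)⁻¹) H + s • cfc (fun x : ℝ => (x + s)⁻¹) H = 1 := by
  have hcont (f : ℝ → ℝ) : ContinuousOn f (spectrum ℝ H) := finite_real_spectrum.continuousOn f
  have hid (x : ℝ) (hx : x ∈ spectrum ℝ H) : x * (x + s)⁻¹ + s * (x + s)⁻¹ = 1 := by
    have : 0 ≤ x := spectrum_nonneg_of_nonneg hH.nonneg hx
    rw [← add_mul, mul_inv_cancel₀ (by positivity)]
  rw [← cfc_self_mul hH.isHermitian, ← cfc_const_mul _ _ _ (hcont _),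
    ← cfc_add _ _ _ (hcont _) (hcont _), cfc_congr hid,
    cfc_const_one ℝ H hH.isHermitian.isSelfAdjoint]

theorem doubleOperatorIntegral_stein (hA : A.PosSemidef) (hC : C.PosSemidef) (hs : 0 < s) :
    A * doubleOperatorIntegral hA.isHermitian hC.isHermitian (fun x y => x / (x * y + s)) 1 * C +
      s • doubleOperatorIntegral hA.isHermitian hC.isHermitian (fun x y => x / (x * y + s)) 1 =
      A := by
  have hdiag := cfc_mul_eq_doubleOperatorIntegral hA.isHermitian hC.isHermitian 1 fun x => x
  rw [cfc_id' ℝ A hA.isHermitian.isSelfAdjoint, Matrix.mul_one] at hdiag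
  rw [mul_doubleOperatorIntegral, doubleOperatorIntegral_mul, doubleOperatorIntegral_add_smul]
  refine (doubleOperatorIntegral_congr _ _ _ fun i j => ?_).trans hdiag.symm
  have := mul_nonneg (hA.eigenvalues_nonneg i) (hC.eigenvalues_nonneg j)
  field_simp

theorem doubleOperatorIntegral_sylvester (hM : M.PosSemidef) (hA : A.PosSemidef) (hs : 0 < s) :
    M * doubleOperatorIntegral hM.isHermitian hA.isHermitian (fun x y => y / (x + s * y)) 1 +
      s • (doubleOperatorIntegral hM.isHermitian hA.isHermitian (fun x y => y / (x + s * y)) 1 *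
        A) = A := by
  have hdiag := mul_cfc_eq_doubleOperatorIntegral hM.isHermitian hA.isHermitian 1 fun x => x
  rw [cfc_id' ℝ A hA.isHermitian.isSelfAdjoint, Matrix.one_mul] at hdiag
  rw [mul_doubleOperatorIntegral, doubleOperatorIntegral_mul, doubleOperatorIntegral_add_smul]
  refine (doubleOperatorIntegral_congr _ _ _ fun i j => ?_).trans hdiag.symm
  have hx := hM.eigenvalues_nonneg i
  have hy := hA.eigenvalues_nonneg j
  rcases hy.eq_or_lt with hy | hy
  · simp [← hy]
  · field_simp

theorem spectralForm_resolvent_le_of_sylvester (hS : Sᴴ = S) (hSA : S * S = A)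
    (hSCS : S * C * S = M) (hA : A.PosSemidef) (hC : C.PosSemidef) (hM : M.PosSemidef)
    (hs : 0 < s) :
    spectralForm hM.isHermitian hA.isHermitian 1 (fun x y => x * y / (x / y + s)) ≤
      spectralForm hC.isHermitian hC.isHermitian A fun x y => x / (y + s) := by
  have hQ : (cfc (fun x : ℝ => (x + s)⁻¹) C)ᴴ = cfc (fun x : ℝ => (x + s)⁻¹) C :=
    (IsSelfAdjoint.cfc : IsSelfAdjoint (cfc _ C))
  have h := re_trace_mul_mul_le_of_sylvester hS hSA hC hSCS hs hQ (mul_cfc_inv_add hC hs)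
    (doubleOperatorIntegral_sylvester hM hA hs)
  have hl := trace_conjTranspose_mul_doubleOperatorIntegral hM.isHermitian hA.isHermitian 1
    fun x y => x * (y / (x + s * y)) * y
  have hr := trace_conjTranspose_mul_cfc_mul_mul_cfc hC.isHermitian hC.isHermitian A
    (fun x => x) fun y => (y + s)⁻¹
  rw [conjTranspose_one, Matrix.one_mul] at hl
  rw [cfc_id' ℝ C hC.isHermitian.isSelfAdjoint, hA.isHermitian.eq, ← Matrix.mul_assoc,
    ← Matrix.mul_assoc] at hr
  rw [mul_doubleOperatorIntegral, doubleOperatorIntegral_mul, hl, hr, RCLike.ofReal_re,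
    RCLike.ofReal_re] at h
  refine (Eq.le (spectralForm_congr _ _ _ fun i j => ?_)).trans h
  rcases (hA.eigenvalues_nonneg j).eq_or_lt with hy | hy
  · simp [← hy]
  · field_simp

theorem spectralForm_resolvent_le_of_stein (hS : Sᴴ = S) (hSA : S * S = A)
    (hSCS : S * C * S = M) (hA : A.PosSemidef) (hC : C.PosSemidef) (hM : M.PosSemidef)
    (hs : 0 < s) :
    spectralForm hA.isHermitian hC.isHermitian 1 (fun x y => x ^ 2 * y / (x * y + s)) ≤
      spectralForm hM.isHermitian hA.isHermitian 1 fun x y => x * y / (x + s) := by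
  set R := cfc (fun x : ℝ => (x + s)⁻¹) M with hR
  have hR' : Rᴴ = R := (IsSelfAdjoint.cfc : IsSelfAdjoint (cfc _ M))
  have hW : (S * R * S)ᴴ = S * R * S := by
    simp only [conjTranspose_mul, hS, hR', Matrix.mul_assoc]
  have hAW : A * C * (S * R * S) + s • (S * R * S) = A := by
    have h : S * (M * R + s • R) * S = A := by rw [mul_cfc_inv_add hM hs, Matrix.mul_one, hSA]
    refine Eq.trans ?_ h
    rw [← hSCS, ← hSA]
    simp only [Matrix.mul_add, Matrix.add_mul, Matrix.mul_smul, Matrix.smul_mul, Matrix.mul_assoc]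
  have h := re_trace_mul_mul_le_of_stein hA hC hs hW hAW (doubleOperatorIntegral_stein hA hC hs)
  have hl := trace_conjTranspose_mul_doubleOperatorIntegral hA.isHermitian hC.isHermitian 1
    fun x y => x * (x / (x * y + s)) * y
  have hr := trace_cfc_mul_cfc hM.isHermitian hA.isHermitian (fun x => x * (x + s)⁻¹) fun y => y
  have htrace : (A * C * (S * R * S)).trace = (M * R * A).trace := by
    rw [← hSA, ← hSCS, Matrix.mul_assoc S, Matrix.mul_assoc S, trace_mul_comm S]
    simp only [Matrix.mul_assoc]
  rw [cfc_self_mul hM.isHermitian, ← hR, cfc_id' ℝ A hA.isHermitian.isSelfAdjoint, ← htrace] at hr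
  rw [conjTranspose_one, Matrix.one_mul] at hl
  rw [mul_doubleOperatorIntegral, doubleOperatorIntegral_mul, hl, hr, RCLike.ofReal_re,
    RCLike.ofReal_re] at h
  refine (Eq.le (spectralForm_congr _ _ _ fun i j => ?_)).trans
    (h.trans_eq (spectralForm_congr _ _ _ fun i j => ?_)) <;> ring

theorem trace_mul_mul_cfc_eq_spectralForm (hM : M.IsHermitian) (hA : A.IsHermitian) (f : ℝ → ℝ) :
    (A * M * cfc f M).trace = (spectralForm hM hA 1 (fun x y => x * f x * y) : 𝕜) := by
  rw [← trace_cfc_mul_cfc hM hA (fun x => x * f x) fun y => y, cfc_id' ℝ A hA.isSelfAdjoint,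
    cfc_self_mul hM, trace_mul_comm _ A, ← Matrix.mul_assoc]

theorem trace_mul_mul_mul_cfc_eq_spectralForm_conj (hSA : S * S = A) (hSCS : S * C * S = M)
    (hM : M.IsHermitian) (hA : A.IsHermitian) (f : ℝ → ℝ) :
    (A * C * A * cfc f A).trace = (spectralForm hM hA 1 (fun x y => x * (y * f y)) : 𝕜) := by
  have hSf : cfc f A * S = S * cfc f A :=
    cfc_mul_eq_mul_cfc hA hA f (by rw [← hSA, Matrix.mul_assoc])
  have hM' : M * (A * cfc f A) = S * C * A * (cfc f A * S) := by
    rw [hSf, ← hSCS, ← hSA]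
    simp only [Matrix.mul_assoc]
  rw [← trace_cfc_mul_cfc hM hA (fun x => x) fun y => y * f y, cfc_self_mul hA,
    cfc_id' ℝ M hM.isSelfAdjoint, hM', ← Matrix.mul_assoc, trace_mul_comm _ S]
  nth_rw 1 [← hSA]
  simp only [Matrix.mul_assoc]

theorem trace_mul_mul_mul_cfc_eq_spectralForm (hA : A.IsHermitian) (hC : C.IsHermitian)
    (f : ℝ → ℝ) :
    (A * C * A * cfc f C).trace = (spectralForm hC hC A (fun x y => x * f y) : 𝕜) := by
  rw [← trace_conjTranspose_mul_cfc_mul_mul_cfc hC hC A (fun x => x) f,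
    cfc_id' ℝ C hC.isSelfAdjoint, hA.eq]
  simp only [Matrix.mul_assoc]

theorem trace_sq_mul_mul_cfc_left_eq_spectralForm (hA : A.IsHermitian) (hC : C.IsHermitian)
    (f : ℝ → ℝ) :
    (A ^ 2 * C * cfc f A).trace = (spectralForm hA hC 1 (fun x y => x * (x * f x) * y) : 𝕜) := by
  rw [← trace_cfc_mul_cfc hA hC (fun x => x * (x * f x)) fun y => y, cfc_self_mul hA,
    cfc_self_mul hA, cfc_id' ℝ C hC.isSelfAdjoint, trace_mul_comm, ← Matrix.mul_assoc,
    cfc_mul_eq_mul_cfc hA hA f (pow_mul_comm' A 2).symm, pow_two, Matrix.mul_assoc A]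

theorem trace_sq_mul_mul_cfc_right_eq_spectralForm (hA : A.IsHermitian) (hC : C.IsHermitian)
    (f : ℝ → ℝ) :
    (A ^ 2 * C * cfc f C).trace = (spectralForm hA hC 1 (fun x y => x ^ 2 * (y * f y)) : 𝕜) := by
  rw [← trace_cfc_mul_cfc hA hC (fun x => x ^ 2) fun y => y * f y,
    cfc_pow_id A 2 hA.isSelfAdjoint, cfc_self_mul hC, Matrix.mul_assoc]

theorem mul_mul_log_div (x y : ℝ) :
    x * y * Real.log (x / y) + x * (y * Real.log y) = x * Real.log x * y := by
  rcases eq_or_ne x 0 with rfl | hx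
  · simp
  rcases eq_or_ne y 0 with rfl | hy
  · simp
  rw [Real.log_div hx hy]
  ring

theorem sq_mul_mul_log_mul (x y : ℝ) :
    x ^ 2 * y * Real.log (x * y) = x * (x * Real.log x) * y + x ^ 2 * (y * Real.log y) := by
  rcases eq_or_ne x 0 with rfl | hx
  · simp
  rcases eq_or_ne y 0 with rfl | hy
  · simp
  rw [Real.log_mul hx hy]
  ring

theorem trace_mul_mul_mul_log_add_log_le (hS : Sᴴ = S) (hSA : S * S = A)
    (hSCS : S * C * S = M) (hC : C.PosDef) :
    (A * C * A * (cfc Real.log A + cfc Real.log C)).trace ≤ (A * M * cfc Real.log M).trace := by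
  have hA : A.PosSemidef := by simpa only [hS, hSA] using posSemidef_self_mul_conjTranspose S
  have hM : M.PosSemidef := by
    simpa only [hS, hSCS] using hC.posSemidef.mul_mul_conjTranspose_same S
  have hAH := hA.isHermitian
  have hCH := hC.isHermitian
  have hMH := hM.isHermitian
  have htrA := trace_mul_mul_mul_cfc_eq_spectralForm_conj hSA hSCS hMH hAH
  have htrC := trace_mul_mul_mul_cfc_eq_spectralForm hAH hCH
  have hmass : spectralForm hMH hAH 1 (fun x y => x * y) = spectralForm hCH hCH A fun x _ => x := by
    have h := (htrA fun _ => 1).symm.trans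
      (.trans (by rw [cfc_const_one ℝ A, cfc_const_one ℝ C]) (htrC fun _ => 1))
    simpa only [mul_one, RCLike.ofReal_inj] using h
  have h := spectralForm_mul_log_le_of_spectralForm_div_add_le hMH hAH 1 hCH hCH A
    (φ := fun x y => x * y) (τ := fun x y => x / y) (φ' := fun x _ => x) (τ' := fun _ y => y)
    (fun i j => div_nonneg (hM.eigenvalues_nonneg i) (hA.eigenvalues_nonneg j))
    (fun _ j => hC.posSemidef.eigenvalues_nonneg j)
    (fun i j h => mul_eq_zero.mpr (div_eq_zero_iff.mp h))
    (fun _ j h => absurd h (hC.eigenvalues_pos j).ne')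
    hmass fun s => spectralForm_resolvent_le_of_sylvester hS hSA hSCS hA hC.posSemidef hM
  have hlog_div : spectralForm hMH hAH 1 (fun x y => x * y * Real.log (x / y)) +
      spectralForm hMH hAH 1 (fun x y => x * (y * Real.log y)) =
        spectralForm hMH hAH 1 fun x y => x * Real.log x * y := by
    simp only [← spectralForm_add, mul_mul_log_div]
  rw [Matrix.mul_add, trace_add, htrA, htrC, trace_mul_mul_cfc_eq_spectralForm hMH hAH,
    ← RCLike.ofReal_add, RCLike.ofReal_le_ofReal]
  linarith

theorem trace_mul_mul_log_le (hS : Sᴴ = S) (hSA : S * S = A)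
    (hSCS : S * C * S = M) (hC : C.PosSemidef) :
    (A * M * cfc Real.log M).trace ≤ (A ^ 2 * C * (cfc Real.log A + cfc Real.log C)).trace := by
  have hA : A.PosSemidef := by simpa only [hS, hSA] using posSemidef_self_mul_conjTranspose S
  have hM : M.PosSemidef := by simpa only [hS, hSCS] using hC.mul_mul_conjTranspose_same S
  have hAH := hA.isHermitian
  have hCH := hC.isHermitian
  have hMH := hM.isHermitian
  have htrM := trace_mul_mul_cfc_eq_spectralForm hMH hAH
  have htrC := trace_sq_mul_mul_cfc_right_eq_spectralForm hAH hCH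
  have hmass : spectralForm hAH hCH 1 (fun x y => x ^ 2 * y) =
      spectralForm hMH hAH 1 fun x y => x * y := by
    have htrace : (A ^ 2 * C).trace = (A * M).trace := by
      rw [← hSCS, ← Matrix.mul_assoc, trace_mul_comm _ S, pow_two, ← hSA]
      simp only [Matrix.mul_assoc]
    have h := (htrC fun _ => 1).symm.trans (.trans
      (by rw [cfc_const_one ℝ C, cfc_const_one ℝ M, Matrix.mul_one, Matrix.mul_one, htrace])
      (htrM fun _ => 1))
    simpa only [mul_one, RCLike.ofReal_inj] using h
  have h := spectralForm_mul_log_le_of_spectralForm_div_add_le hAH hCH 1 hMH hAH 1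
    (φ := fun x y => x ^ 2 * y) (τ := fun x y => x * y) (φ' := fun x y => x * y)
    (τ' := fun x _ => x)
    (fun i j => mul_nonneg (hA.eigenvalues_nonneg i) (hC.eigenvalues_nonneg j))
    (fun i _ => hM.eigenvalues_nonneg i)
    (fun i j h => by rw [pow_two, mul_assoc, h, mul_zero])
    (fun i j h => mul_eq_zero_of_left h _)
    hmass fun s => spectralForm_resolvent_le_of_stein hS hSA hSCS hA hC hM
  have hlog_mul : spectralForm hAH hCH 1 (fun x y => x ^ 2 * y * Real.log (x * y)) =
      spectralForm hAH hCH 1 (fun x y => x * (x * Real.log x) * y) +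
        spectralForm hAH hCH 1 fun x y => x ^ 2 * (y * Real.log y) := by
    simp only [← spectralForm_add, sq_mul_mul_log_mul]
  rw [Matrix.mul_add, trace_add, trace_sq_mul_mul_cfc_left_eq_spectralForm hAH hCH, htrC, htrM,
    ← RCLike.ofReal_add, RCLike.ofReal_le_ofReal, ← hlog_mul]
  simpa only [mul_right_comm] using h

end LogInequalities

section Powers

open Matrix

variable {n 𝕜 : Type*} [Fintype n] [DecidableEq n] [RCLike 𝕜] {A B M S : Matrix n n 𝕜}

theorem trace_mul_mul_cfc_comm (hM : M.IsHermitian) (X : Matrix n n 𝕜) (f : ℝ → ℝ) :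
    (M * X * cfc f M).trace = (X * M * cfc f M).trace := by
  rw [Matrix.mul_assoc, trace_mul_comm, Matrix.mul_assoc, Matrix.mul_assoc,
    cfc_mul_eq_mul_cfc hM hM f rfl]

theorem trace_conj_sq_mul_cfc {E : Matrix n n 𝕜} (hS : Sᴴ = S) (hE : Eᴴ = E) (hSA : S * S = A)
    (hSEES : S * (E * E) * S = M) (f : ℝ → ℝ) :
    (E * A ^ 2 * E * cfc f (E * A * E)).trace = (A * M * cfc f M).trace := by
  have hM : M.IsHermitian := by
    simp only [IsHermitian, ← hSEES, conjTranspose_mul, hS, hE, Matrix.mul_assoc]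
  have hN : (E * A * E).IsHermitian := by
    simp only [IsHermitian, ← hSA, conjTranspose_mul, hS, hE, Matrix.mul_assoc]
  have hintertwine : cfc f M * (S * E) = S * E * cfc f (E * A * E) :=
    cfc_mul_eq_mul_cfc hM hN f (by simp only [← hSEES, ← hSA, Matrix.mul_assoc])
  calc (E * A ^ 2 * E * cfc f (E * A * E)).trace
      = (E * S * A * (S * E * cfc f (E * A * E))).trace := by
        simp only [← hSA, pow_two, Matrix.mul_assoc]
    _ = (M * A * cfc f M).trace := by
        rw [← hintertwine, ← Matrix.mul_assoc, trace_mul_comm, ← hSEES]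
        simp only [Matrix.mul_assoc]
    _ = (A * M * cfc f M).trace := trace_mul_mul_cfc_comm hM A f

theorem conjTranspose_rpow (A : Matrix n n 𝕜) (r : ℝ) : (A ^ r)ᴴ = A ^ r :=
  CFC.rpow_nonneg.isSelfAdjoint

theorem rpow_half_mul_self (hA : A.PosSemidef) : A ^ (1 / 2 : ℝ) * A ^ (1 / 2 : ℝ) = A := by
  rw [← CFC.sqrt_eq_rpow, CFC.sqrt_mul_sqrt_self A hA.nonneg]

theorem rpow_three_half (hA : A.PosSemidef) : A ^ (3 / 2 : ℝ) = A * A ^ (1 / 2 : ℝ) := by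
  rw [CFC.rpow_eq_cfc_real hA.nonneg, CFC.rpow_eq_cfc_real hA.nonneg,
    ← cfc_self_mul hA.isHermitian]
  refine cfc_congr fun x hx => ?_
  rw [show (3 / 2 : ℝ) = 1 + 1 / 2 by norm_num,
    Real.rpow_one_add' (spectrum_nonneg_of_nonneg hA.nonneg hx) (by norm_num)]

theorem rpow_neg_half_mul_self (hB : B.PosDef) :
    B ^ (-(1 / 2) : ℝ) * B ^ (-(1 / 2) : ℝ) = B⁻¹ := by
  rw [← CFC.rpow_add hB.isUnit, ← neg_add, add_halves, nonsing_inv_eq_ringInverse]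
  obtain ⟨U, rfl⟩ := hB.isUnit
  rw [CFC.rpow_neg_one_eq_inv U hB.posSemidef.nonneg, Ring.inverse_unit]

theorem cfc_log_inv (hB : B.PosDef) : cfc Real.log B⁻¹ = -cfc Real.log B := by
  obtain ⟨U, rfl⟩ := hB.isUnit
  rw [← coe_units_inv, ← cfc_comp_inv _ U ((finite_real_spectrum.image _).continuousOn _)
    hB.isHermitian.isSelfAdjoint]
  simp only [Real.log_inv, cfc_neg]

end Powers

open scoped Matrix in
theorem proposition7p1_general {n 𝕜 : Type*} [Fintype n] [DecidableEq n] [RCLike 𝕜]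
    (A B : Matrix n n 𝕜) (hA : A.PosSemidef) (hB : B.PosDef) :
    RCLike.im (A ^ (1 / 2 : ℝ) * B⁻¹ * A ^ (3 / 2 : ℝ) *
        cfc Real.log (A ^ (1 / 2 : ℝ) * B⁻¹ * A ^ (1 / 2 : ℝ))).trace = 0 ∧
    (A * B⁻¹ * A * (cfc Real.log A - cfc Real.log B)).trace ≤
      (A ^ (1 / 2 : ℝ) * B⁻¹ * A ^ (3 / 2 : ℝ) *
        cfc Real.log (A ^ (1 / 2 : ℝ) * B⁻¹ * A ^ (1 / 2 : ℝ))).trace ∧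
    (A ^ (1 / 2 : ℝ) * B⁻¹ * A ^ (3 / 2 : ℝ) *
        cfc Real.log (A ^ (1 / 2 : ℝ) * B⁻¹ * A ^ (1 / 2 : ℝ))).trace =
      (B ^ (-(1 / 2) : ℝ) * A ^ 2 * B ^ (-(1 / 2) : ℝ) *
        cfc Real.log (B ^ (-(1 / 2) : ℝ) * A * B ^ (-(1 / 2) : ℝ))).trace ∧
    (B ^ (-(1 / 2) : ℝ) * A ^ 2 * B ^ (-(1 / 2) : ℝ) *
        cfc Real.log (B ^ (-(1 / 2) : ℝ) * A * B ^ (-(1 / 2) : ℝ))).trace =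
      (A ^ (3 / 2 : ℝ) * B⁻¹ * A ^ (1 / 2 : ℝ) *
        cfc Real.log (A ^ (1 / 2 : ℝ) * B⁻¹ * A ^ (1 / 2 : ℝ))).trace ∧
    (A ^ (3 / 2 : ℝ) * B⁻¹ * A ^ (1 / 2 : ℝ) *
        cfc Real.log (A ^ (1 / 2 : ℝ) * B⁻¹ * A ^ (1 / 2 : ℝ))).trace ≤
      (A ^ 2 * B⁻¹ * (cfc Real.log A - cfc Real.log B)).trace := by
  set S := A ^ (1 / 2 : ℝ)
  set M := S * B⁻¹ * S with hM
  have hS : Sᴴ = S := conjTranspose_rpow A _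
  have hSA : S * S = A := rpow_half_mul_self hA
  have hMH : M.IsHermitian := by
    simpa only [hS] using (hB.inv.posSemidef.mul_mul_conjTranspose_same S).isHermitian
  have hA32 : A ^ (3 / 2 : ℝ) = A * S := rpow_three_half hA
  have hleft : S * B⁻¹ * A ^ (3 / 2 : ℝ) = M * A := by
    rw [hA32, hM, Matrix.mul_assoc _ S, ← hSA, Matrix.mul_assoc S S S]
  have hright : A ^ (3 / 2 : ℝ) * B⁻¹ * S = A * M := by
    simp only [hA32, hM, Matrix.mul_assoc]
  have hmid := trace_conj_sq_mul_cfc hS (conjTranspose_rpow B _) hSA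
    (by rw [rpow_neg_half_mul_self hB]) Real.log
  have hlog : cfc Real.log A - cfc Real.log B = cfc Real.log A + cfc Real.log B⁻¹ := by
    rw [cfc_log_inv hB, sub_eq_add_neg]
  rw [hleft, hright, hlog, hmid, trace_mul_mul_cfc_comm hMH]
  refine ⟨?_, trace_mul_mul_mul_log_add_log_le hS hSA hM.symm hB.inv, rfl, rfl,
    trace_mul_mul_log_le hS hSA hM.symm hB.inv.posSemidef⟩
  rw [trace_mul_mul_cfc_eq_spectralForm hMH hA.isHermitian, RCLike.ofReal_im]

/-- Real powers of positive matrices are those of the continuous functional calculus, and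
`cfc Real.log` is the matrix logarithm; on a singular matrix it takes the value `0` on the
kernel, which is the convention `0 log 0 = 0`. The traces are compared in `ℂ`, where `z ≤ w`
means `z.re ≤ w.re` and `z.im = w.im`; the first conjunct says that they are all real. -/
theorem proposition7p1 (n : ℕ) (A B : Matrix (Fin n) (Fin n) ℂ)
    (hA : A.PosSemidef) (hB : B.PosDef) :
    (A ^ (1 / 2 : ℝ) * B⁻¹ * A ^ (3 / 2 : ℝ) *
        cfc Real.log (A ^ (1 / 2 : ℝ) * B⁻¹ * A ^ (1 / 2 : ℝ))).trace.im = 0 ∧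
    (A * B⁻¹ * A * (cfc Real.log A - cfc Real.log B)).trace ≤
      (A ^ (1 / 2 : ℝ) * B⁻¹ * A ^ (3 / 2 : ℝ) *
        cfc Real.log (A ^ (1 / 2 : ℝ) * B⁻¹ * A ^ (1 / 2 : ℝ))).trace ∧
    (A ^ (1 / 2 : ℝ) * B⁻¹ * A ^ (3 / 2 : ℝ) *
        cfc Real.log (A ^ (1 / 2 : ℝ) * B⁻¹ * A ^ (1 / 2 : ℝ))).trace =
      (B ^ (-(1 / 2) : ℝ) * A ^ 2 * B ^ (-(1 / 2) : ℝ) *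
        cfc Real.log (B ^ (-(1 / 2) : ℝ) * A * B ^ (-(1 / 2) : ℝ))).trace ∧
    (B ^ (-(1 / 2) : ℝ) * A ^ 2 * B ^ (-(1 / 2) : ℝ) *
        cfc Real.log (B ^ (-(1 / 2) : ℝ) * A * B ^ (-(1 / 2) : ℝ))).trace =
      (A ^ (3 / 2 : ℝ) * B⁻¹ * A ^ (1 / 2 : ℝ) *
        cfc Real.log (A ^ (1 / 2 : ℝ) * B⁻¹ * A ^ (1 / 2 : ℝ))).trace ∧
    (A ^ (3 / 2 : ℝ) * B⁻¹ * A ^ (1 / 2 : ℝ) *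
        cfc Real.log (A ^ (1 / 2 : ℝ) * B⁻¹ * A ^ (1 / 2 : ℝ))).trace ≤
      (A ^ 2 * B⁻¹ * (cfc Real.log A - cfc Real.log B)).trace :=
  proposition7p1_general A B hA hB
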